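/- Let $R$ be an associative ring with unit which is right hereditary (every right ideal is projective) or right perfect (every right module has a projective cover), and work in the category $\mathrm{Mod}\text{-}R$ of all right $R$-modules. A torsion class is a class of modules closed under epimorphic images, extensions and arbitrary direct sums, and $\mathrm{Gen}(T)$ denotes the class of all epimorphic images of direct sums of copies of $T$. For a homomorphism $\sigma:P_{-1}\to P_0$ between projective modules let $\mathcal D_\sigma$ be the class of all modules $X$ such that $\mathrm{Hom}_R(\sigma,X):\mathrm{Hom}_R(P_0,X)\to\mathrm{Hom}_R(P_{-1},X)$ is surjective. A module $T$ is silting if it has a projective presentation $P_{-1}\xrightarrow{\sigma}P_0\to T\to 0$ such that $\mathcal D_\sigma$ is a torsion class, $T\in\mathcal D_\sigma$ and $\mathcal D_\sigma=\mathrm{Gen}(T)$. For a class $\mathcal T$ of modules, a $\mathcal T$-preenvelope of a module $X$ is a homomorphism $\epsilon:X\to M$ with $M\in\mathcal T$ such that every homomorphism from $X$ to a module in $\mathcal T$ factors through $\epsilon$; it is a $\mathcal T$-envelope if moreover every endomorphism $\alpha$ of $M$ with $\alpha\epsilon=\epsilon$ is an automorphism. The class $\mathcal T$ is enveloping if every module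 has a $\mathcal T$-envelope. A silting module $T$ is minimal if the regular module $R$ has a $\mathrm{Gen}(T)$-envelope. Let $\mathcal T\subseteq\mathrm{Mod}\text{-}R$ be a torsion class. Then the following are equivalent: 1. $\mathcal T=\mathrm{Gen}(T)$ for some minimal silting module $T$; 2. there exists a $\mathcal T$-envelope $\epsilon:R\to M$ of the regular module $R$. In particular, if $\mathcal T$ is enveloping, then $\mathcal T=\mathrm{Gen}(T)$ for some silting module $T$. -/

import Mathlib

open CategoryTheory

universe u

namespace Silting

/-- The category `Mod-R` of right `R`-modules, i.e. of left modules over the opposite ring. -/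
abbrev RightMod (R : Type u) [Ring R] : Type (u + 1) := ModuleCat.{u} Rᵐᵒᵖ

/-- A class of right `R`-modules. -/
abbrev ModClass (R : Type u) [Ring R] : Type (u + 1) := ObjectProperty (RightMod R)

/-- The regular right module `R`. -/
abbrev regular (R : Type u) [Ring R] : RightMod R := ModuleCat.of Rᵐᵒᵖ R

variable {R : Type u} [Ring R]

/-! ### Rings -/

/-- `R` is right hereditary if every right ideal is projective (as a right module). -/
def IsRightHereditary (R : Type u) [Ring R] : Prop :=
  ∀ I : Submodule Rᵐᵒᵖ R, Module.Projective Rᵐᵒᵖ I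

/-- `K` is a superfluous (small) submodule of `P`. -/
def IsSuperfluous {P : RightMod R} (K : Submodule Rᵐᵒᵖ P) : Prop :=
  ∀ N : Submodule Rᵐᵒᵖ P, K ⊔ N = ⊤ → N = ⊤

/-- `π : P → M` is a projective cover of `M`. -/
structure IsProjectiveCover {P M : RightMod R} (π : P →ₗ[Rᵐᵒᵖ] M) : Prop where
  projective : Module.Projective Rᵐᵒᵖ P
  surjective : Function.Surjective π
  superfluous : IsSuperfluous (LinearMap.ker π)

/-- `R` is right perfect if every right module has a projective cover. -/
def IsRightPerfect (R : Type u) [Ring R] : Prop :=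
  ∀ M : RightMod R, ∃ (P : RightMod R) (π : P →ₗ[Rᵐᵒᵖ] M), IsProjectiveCover π

/-! ### Torsion classes and generated classes -/

/-- A torsion class: closed under epimorphic images, extensions and arbitrary direct sums. -/
structure IsTorsionClass (𝒯 : ModClass R) : Prop where
  quotient : ∀ {X Y : RightMod R} (f : X →ₗ[Rᵐᵒᵖ] Y), Function.Surjective f → 𝒯 X → 𝒯 Y
  extension : ∀ {X Y Z : RightMod R} (f : X →ₗ[Rᵐᵒᵖ] Y) (g : Y →ₗ[Rᵐᵒᵖ] Z),
    Function.Injective f → Function.Exact f g → Function.Surjective g → 𝒯 X → 𝒯 Z → 𝒯 Y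
  directSum : ∀ (I : Type u) (X : I → RightMod R), (∀ i, 𝒯 (X i)) →
    𝒯 (ModuleCat.of Rᵐᵒᵖ (DirectSum I fun i => X i))

/-- `Gen(T)`: the epimorphic images of direct sums `T^(I)` of copies of `T`. -/
def Gen (T : RightMod R) : ModClass R := fun X =>
  ∃ (I : Type u) (f : (I →₀ T) →ₗ[Rᵐᵒᵖ] X), Function.Surjective f

/-! ### Silting modules -/

/-- `𝒟_σ`: the modules `X` such that `Hom(σ, X) : Hom(P₀, X) → Hom(P₁, X)` is surjective. -/
def classD {P₁ P₀ : RightMod R} (σ : P₁ →ₗ[Rᵐᵒᵖ] P₀) : ModClass R := fun X =>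
  ∀ f : P₁ →ₗ[Rᵐᵒᵖ] X, ∃ g : P₀ →ₗ[Rᵐᵒᵖ] X, g ∘ₗ σ = f

/-- `P₁ --σ--> P₀ --p--> T --> 0` is a projective presentation of `T`. -/
structure IsProjectivePresentation {P₁ P₀ T : RightMod R}
    (σ : P₁ →ₗ[Rᵐᵒᵖ] P₀) (p : P₀ →ₗ[Rᵐᵒᵖ] T) : Prop where
  projective₁ : Module.Projective Rᵐᵒᵖ P₁
  projective₀ : Module.Projective Rᵐᵒᵖ P₀
  exact : Function.Exact σ p
  surjective : Function.Surjective p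

/-- `T` is partial silting with respect to the projective presentation
`P₁ --σ--> P₀ --p--> T --> 0`. -/
structure IsPartialSiltingWith {P₁ P₀ T : RightMod R}
    (σ : P₁ →ₗ[Rᵐᵒᵖ] P₀) (p : P₀ →ₗ[Rᵐᵒᵖ] T) : Prop where
  presentation : IsProjectivePresentation σ p
  torsion : IsTorsionClass (classD σ)
  mem : classD σ T

/-- `T` is a silting module: it is partial silting with respect to some projective presentation
`σ` for which `𝒟_σ = Gen(T)`. -/
def IsSilting (T : RightMod R) : Prop :=
  ∃ (P₁ P₀ : RightMod R) (σ : P₁ →ₗ[Rᵐᵒᵖ] P₀) (p : P₀ →ₗ[Rᵐᵒᵖ] T),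
    IsPartialSiltingWith σ p ∧ classD σ = Gen T

/-! ### Envelopes -/

/-- `ε : X → M` is a `𝒯`-preenvelope. -/
structure IsPreenvelope (𝒯 : ModClass R) {X M : RightMod R} (ε : X →ₗ[Rᵐᵒᵖ] M) : Prop where
  mem : 𝒯 M
  factors : ∀ (N : RightMod R), 𝒯 N → ∀ f : X →ₗ[Rᵐᵒᵖ] N, ∃ g : M →ₗ[Rᵐᵒᵖ] N, g ∘ₗ ε = f

/-- `ε : X → M` is a `𝒯`-envelope. -/
structure IsEnvelope (𝒯 : ModClass R) {X M : RightMod R} (ε : X →ₗ[Rᵐᵒᵖ] M) : Prop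
    extends IsPreenvelope 𝒯 ε where
  minimal : ∀ α : M →ₗ[Rᵐᵒᵖ] M, α ∘ₗ ε = ε → Function.Bijective α

/-- The module `X` has a `𝒯`-envelope. -/
def HasEnvelope (𝒯 : ModClass R) (X : RightMod R) : Prop :=
  ∃ (M : RightMod R) (ε : X →ₗ[Rᵐᵒᵖ] M), IsEnvelope 𝒯 ε

/-- `𝒯` is enveloping: every module has a `𝒯`-envelope. -/
def IsEnveloping (𝒯 : ModClass R) : Prop := ∀ X : RightMod R, HasEnvelope 𝒯 X

/-- A silting module `T` is minimal if the regular module has a `Gen(T)`-envelope. -/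
structure IsMinimalSilting (T : RightMod R) : Prop where
  silting : IsSilting T
  envelope : HasEnvelope (Gen T) (regular R)

end Silting

/-! ### Submodules of projective modules over hereditary rings -/

namespace Silting

section LeftModules

variable {A : Type u} [Ring A]

/-! Let `ε : R → M` be a `𝒯`-envelope. Elements of `X` in `𝒯` are maps `R → X` and factor through
`ε`, so `M` generates `𝒯`. An extension of `M` by a module of `𝒯` stays in `𝒯`; `ε` lifts to it, and
minimality of `ε` splits it. So `M` is Ext-projective in `𝒯`, and either ring hypothesis turns this
into a projective presentation `σ` of `M` with `𝒯 ⊆ 𝒟_σ` (`IsEnvelope.exists_presentation`). This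
`𝒟_σ` may be too large. Adding a lift of `ε` to the relations gives a presentation `τ` of `Coker ε`
with `𝒟_τ = 𝒯` (`IsPreenvelope.classD_coprod_eq`). Then `σ ⊕ τ` presents `M × Coker ε`, with `𝒟 =
𝒟_σ ∩ 𝒟_τ = 𝒯`, and the summand `M` ensures generation. -/

theorem exists_factor_of_ker_le {P M X : Type u} [AddCommGroup P] [Module A P] [AddCommGroup M]
    [Module A M] [AddCommGroup X] [Module A X] {p : P →ₗ[A] M} (hp : Function.Surjective p)
    {g : P →ₗ[A] X} (h : LinearMap.ker p ≤ LinearMap.ker g) : ∃ g' : M →ₗ[A] X, g' ∘ₗ p = g := by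
  let e := p.quotKerEquivOfSurjective hp
  refine ⟨(LinearMap.ker p).liftQ g h ∘ₗ e.symm.toLinearMap, LinearMap.ext fun x => ?_⟩
  have : e.symm (p x) = (LinearMap.ker p).mkQ x := by
    rw [LinearEquiv.symm_apply_eq]
    rfl
  rw [LinearMap.comp_apply, LinearMap.comp_apply, LinearEquiv.coe_coe, this]
  rfl

/-- Every module embeds into an injective module. -/
theorem exists_injective_embedding (X : Type u) [AddCommGroup X] [Module A X] :
    ∃ (Q : ModuleCat.{u} A) (i : X →ₗ[A] Q), Module.Injective A Q ∧ Function.Injective i := by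
  obtain ⟨J⟩ := EnoughInjectives.presentation (ModuleCat.of A X)
  have := J.injective
  exact ⟨J.J, J.f.hom, Module.injective_module_of_injective_object A J.J,
    (ModuleCat.mono_iff_injective J.f).1 J.mono⟩

/-- If all left ideals are projective, then quotients of injective modules are injective. -/
theorem baer_quotient_of_projective_ideals (hA : ∀ I : Ideal A, Module.Projective A I)
    {Q : Type u} [AddCommGroup Q] [Module A Q] (hQ : Module.Injective A Q) (L : Submodule A Q) :
    Module.Baer A (Q ⧸ L) := by
  intro I g
  have := hA I
  obtain ⟨h, hh⟩ := Module.projective_lifting_property L.mkQ g L.mkQ_surjective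
  obtain ⟨h', hh'⟩ := Module.Baer.of_injective hQ I h
  refine ⟨L.mkQ ∘ₗ h', fun x mem => ?_⟩
  rw [LinearMap.comp_apply, hh' x mem]
  exact LinearMap.congr_fun hh ⟨x, mem⟩

/-- If all left ideals are projective, then submodules of projective modules are projective. -/
theorem projective_submodule_of_projective_ideals (hA : ∀ I : Ideal A, Module.Projective A I)
    {P : Type u} [AddCommGroup P] [Module A P] (hP : Module.Projective A P) (K : Submodule A P) :
    Module.Projective A K := by
  refine Module.Projective.of_lifting_property'' fun f hf => ?_
  obtain ⟨Q, i, hQ, hi⟩ := exists_injective_embedding (A := A) (K →₀ A)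
  -- The quotient `Q ⧸ L` is injective, so `q` extends to `P` and then lifts to `Q`. On `K` the lift
  -- has values in the image of `i`, which yields a section of `f`.
  let L : Submodule A Q := (LinearMap.ker f).map i
  obtain ⟨q, hq⟩ : ∃ q : K →ₗ[A] Q ⧸ L, q ∘ₗ f = L.mkQ ∘ₗ i :=
    exists_factor_of_ker_le hf fun y hy =>
      (Submodule.Quotient.mk_eq_zero L).2 (Submodule.mem_map_of_mem hy)
  obtain ⟨q', hq'⟩ := (baer_quotient_of_projective_ideals hA hQ L).extension_property
    K.subtype K.injective_subtype q
  obtain ⟨h, hh⟩ := Module.projective_lifting_property L.mkQ q' L.mkQ_surjective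
  have key : ∀ k : K, ∃ y, i y = h k ∧ f y = k := by
    intro k
    obtain ⟨y, rfl⟩ := hf k
    have h1 : L.mkQ (h (f y)) = L.mkQ (i y) := by
      rw [← LinearMap.comp_apply, hh, ← LinearMap.comp_apply, ← hq, ← hq']
      rfl
    obtain ⟨z, hz, hz'⟩ := (Submodule.Quotient.eq L).1 h1
    refine ⟨y + z, ?_, ?_⟩
    · rw [map_add, hz']
      abel
    · rw [map_add, LinearMap.mem_ker.1 hz, add_zero]
  choose y hy hy' using key
  refine ⟨⟨⟨y, fun a b => hi ?_⟩, fun a b => hi ?_⟩, LinearMap.ext hy'⟩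
  · simp [hy]
  · simp [hy]

end LeftModules

variable {R : Type u} [Ring R]

/-- The regular right module as a left module over the opposite ring. -/
def regularEquiv (R : Type u) [Ring R] : Rᵐᵒᵖ ≃ₗ[Rᵐᵒᵖ] R where
  toFun := MulOpposite.unop
  invFun := MulOpposite.op
  map_add' _ _ := rfl
  map_smul' _ _ := rfl
  left_inv _ := rfl
  right_inv _ := rfl

instance projective_regular (R : Type u) [Ring R] : Module.Projective Rᵐᵒᵖ R :=
  Module.Projective.of_equiv (regularEquiv R)

theorem projective_submodule_of_isRightHereditary (hR : IsRightHereditary R)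
    {P : Type u} [AddCommGroup P] [Module Rᵐᵒᵖ P] (hP : Module.Projective Rᵐᵒᵖ P)
    (K : Submodule Rᵐᵒᵖ P) : Module.Projective Rᵐᵒᵖ K := by
  refine projective_submodule_of_projective_ideals (fun I => ?_) hP K
  have := hR (Submodule.map (regularEquiv R).toLinearMap I)
  exact Module.Projective.of_equiv ((regularEquiv R).submoduleMap I).symm

/-! ### Torsion classes -/

namespace IsTorsionClass

variable {𝒯 : ModClass R}

theorem prod (h𝒯 : IsTorsionClass 𝒯) {X Y : RightMod R} (hX : 𝒯 X) (hY : 𝒯 Y) :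
    𝒯 (ModuleCat.of Rᵐᵒᵖ (X × Y)) :=
  h𝒯.extension (Y := ModuleCat.of Rᵐᵒᵖ (X × Y)) (LinearMap.inl Rᵐᵒᵖ X Y) (LinearMap.snd Rᵐᵒᵖ X Y)
    LinearMap.inl_injective .inl_snd LinearMap.snd_surjective hX hY

theorem of_gen (h𝒯 : IsTorsionClass 𝒯) {T X : RightMod R} (hT : 𝒯 T) (hX : Gen T X) : 𝒯 X := by
  classical
  obtain ⟨I, f, hf⟩ := hX
  let e := finsuppLEquivDirectSum Rᵐᵒᵖ T I
  exact h𝒯.quotient (X := ModuleCat.of Rᵐᵒᵖ (DirectSum I fun _ => T))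
    (f ∘ₗ e.symm.toLinearMap) (hf.comp e.symm.surjective) (h𝒯.directSum I (fun _ => T) fun _ => hT)

end IsTorsionClass

theorem exists_regular_hom {X : Type u} [AddCommGroup X] [Module Rᵐᵒᵖ X] (x : X) :
    ∃ f : R →ₗ[Rᵐᵒᵖ] X, f 1 = x :=
  ⟨LinearMap.toSpanSingleton Rᵐᵒᵖ X x ∘ₗ (regularEquiv R).symm.toLinearMap, by
    change MulOpposite.op (1 : R) • x = x
    rw [MulOpposite.op_one, one_smul]⟩

/-- `X` is generated by `M` as soon as all its elements, viewed as maps `R → X`, factor through a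
fixed map `R → M`. -/
theorem gen_of_factors {M X : RightMod R} (ε : R →ₗ[Rᵐᵒᵖ] M)
    (h : ∀ f : R →ₗ[Rᵐᵒᵖ] X, ∃ g : M →ₗ[Rᵐᵒᵖ] X, g ∘ₗ ε = f) : Gen M X := by
  refine ⟨M →ₗ[Rᵐᵒᵖ] X, Finsupp.lsum ℕ fun g : M →ₗ[Rᵐᵒᵖ] X => g, fun x => ?_⟩
  obtain ⟨f, rfl⟩ := exists_regular_hom (R := R) x
  obtain ⟨g, rfl⟩ := h f
  exact ⟨Finsupp.single g (ε 1), by simp⟩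

/-- Generators of a generator generate. -/
theorem Gen.of_surjective {T M X : RightMod R} (q : T →ₗ[Rᵐᵒᵖ] M) (hq : Function.Surjective q)
    (hX : Gen M X) : Gen T X := by
  obtain ⟨I, f, hf⟩ := hX
  exact ⟨I, f ∘ₗ Finsupp.mapRange.linearMap q,
    hf.comp (Finsupp.mapRange_surjective q (map_zero q) hq)⟩

/-! ### Presentations of envelopes -/

/-- The target of a `𝒯`-envelope of the regular module is Ext-projective in `𝒯`: maps from a
relation module into objects of `𝒯` extend to the cover. -/
theorem IsEnvelope.exists_extension {𝒯 : ModClass R} (h𝒯 : IsTorsionClass 𝒯) {M : RightMod R}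
    {ε : regular R →ₗ[Rᵐᵒᵖ] M} (hε : IsEnvelope 𝒯 ε) {P : Type u} [AddCommGroup P]
    [Module Rᵐᵒᵖ P] (p : P →ₗ[Rᵐᵒᵖ] M) (hp : Function.Surjective p) {X : RightMod R} (hX : 𝒯 X)
    (f : LinearMap.ker p →ₗ[Rᵐᵒᵖ] X) : ∃ g : P →ₗ[Rᵐᵒᵖ] X, ∀ k : LinearMap.ker p, g k = f k := by
  -- The quotient by `N` is the pushout of `f` along `ker p ⊆ P`, an extension of `M` by `X`.
  let N : Submodule Rᵐᵒᵖ (X × P) := LinearMap.range (f.prod (-(LinearMap.ker p).subtype))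
  let i : X →ₗ[Rᵐᵒᵖ] (X × P) ⧸ N := N.mkQ ∘ₗ LinearMap.inl Rᵐᵒᵖ X P
  have hN : N ≤ LinearMap.ker (p ∘ₗ LinearMap.snd Rᵐᵒᵖ X P) := by
    rintro _ ⟨k, rfl⟩
    simp
  let π : (X × P) ⧸ N →ₗ[Rᵐᵒᵖ] M := N.liftQ (p ∘ₗ LinearMap.snd Rᵐᵒᵖ X P) hN
  have hi : Function.Injective i := by
    rw [← LinearMap.ker_eq_bot, LinearMap.ker_eq_bot']
    intro x hx
    obtain ⟨k, hk⟩ := (Submodule.Quotient.mk_eq_zero N).1 hx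
    have h2 : k = 0 := by simpa using congrArg Prod.snd hk
    have h1 : f k = x := congrArg Prod.fst hk
    rw [← h1, h2, map_zero]
  have hπ : Function.Surjective π := by
    intro m
    obtain ⟨y, rfl⟩ := hp m
    exact ⟨N.mkQ (0, y), by simp [π]⟩
  have hker : ∀ e, π e = 0 → ∃ x, i x = e := by
    intro e he
    obtain ⟨⟨x, y⟩, rfl⟩ := N.mkQ_surjective e
    have hy : p y = 0 := by simpa [π] using he
    refine ⟨x + f ⟨y, hy⟩, (Submodule.Quotient.eq N).2 ⟨⟨y, hy⟩, ?_⟩⟩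
    simp
  have hex : Function.Exact i π := by
    intro e
    refine ⟨hker e, ?_⟩
    rintro ⟨x, rfl⟩
    simp [i, π]
  have hE : 𝒯 (ModuleCat.of Rᵐᵒᵖ ((X × P) ⧸ N)) :=
    h𝒯.extension (Y := ModuleCat.of Rᵐᵒᵖ ((X × P) ⧸ N)) i π hi hex hπ hX hε.mem
  obtain ⟨ε', hε'⟩ := Module.projective_lifting_property (P := R) π ε hπ
  -- `π ∘ g` fixes `ε`, hence is an automorphism, and `π` splits.
  obtain ⟨g, hg⟩ := hε.factors _ hE ε'
  have hbij := hε.minimal (π ∘ₗ g) (by rw [LinearMap.comp_assoc, hg]; exact hε')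
  let u := LinearEquiv.ofBijective (π ∘ₗ g) hbij
  let s : M →ₗ[Rᵐᵒᵖ] (X × P) ⧸ N := g ∘ₗ u.symm.toLinearMap
  have hs : ∀ m, π (s m) = m := fun m => u.apply_symm_apply m
  -- Subtracting the section moves `P` into `ker π = X`; on `ker p` nothing is subtracted.
  let G : P →ₗ[Rᵐᵒᵖ] (X × P) ⧸ N := N.mkQ ∘ₗ LinearMap.inr Rᵐᵒᵖ X P - s ∘ₗ p
  have hG : ∀ y, ∃ x, i x = G y := fun y => hker _ (by simp [G, hs]; simp [π])
  choose r hr using hG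
  refine ⟨⟨⟨r, fun a b => hi ?_⟩, fun a b => hi ?_⟩, fun k => hi ?_⟩
  · simp [hr]
  · simp [hr]
  · change i (r k) = i (f k)
    rw [hr]
    have hk : p k = 0 := k.2
    have : N.mkQ (0, (k : P)) = N.mkQ (f k, 0) := by
      refine (Submodule.Quotient.eq N).2 ⟨-k, ?_⟩
      simp
    simpa [G, i, hk] using this

/-- A map out of a projective cover of `K` into `X` extends along `K → P` as soon as all maps from
`K` to quotients of `X` extend to the projective module `P`. -/
theorem IsProjectiveCover.exists_extension {K : Type u} [AddCommGroup K] [Module Rᵐᵒᵖ K]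
    {Q : RightMod R} {q : Q →ₗ[Rᵐᵒᵖ] ModuleCat.of Rᵐᵒᵖ K} (hq : IsProjectiveCover q)
    {P : Type u} [AddCommGroup P] [Module Rᵐᵒᵖ P] [Module.Projective Rᵐᵒᵖ P]
    (j : K →ₗ[Rᵐᵒᵖ] P) {X : Type u} [AddCommGroup X] [Module Rᵐᵒᵖ X]
    (h : ∀ (L : Submodule Rᵐᵒᵖ X) (f : K →ₗ[Rᵐᵒᵖ] X ⧸ L), ∃ g : P →ₗ[Rᵐᵒᵖ] X ⧸ L, g ∘ₗ j = f)
    (f : Q →ₗ[Rᵐᵒᵖ] X) : ∃ g : P →ₗ[Rᵐᵒᵖ] X, g ∘ₗ (j ∘ₗ q) = f := by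
  let L : Submodule Rᵐᵒᵖ X := (LinearMap.ker q).map f
  obtain ⟨f', hf'⟩ : ∃ f' : K →ₗ[Rᵐᵒᵖ] X ⧸ L, f' ∘ₗ q = L.mkQ ∘ₗ f :=
    exists_factor_of_ker_le hq.surjective fun y hy =>
      (Submodule.Quotient.mk_eq_zero L).2 (Submodule.mem_map_of_mem hy)
  obtain ⟨g', hg'⟩ := h L f'
  obtain ⟨g, hg⟩ := Module.projective_lifting_property L.mkQ g' L.mkQ_surjective
  let d : Q →ₗ[Rᵐᵒᵖ] X := f - g ∘ₗ (j ∘ₗ q)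
  have hdL : ∀ x, d x ∈ L := by
    intro x
    refine (Submodule.Quotient.eq L).1 ?_
    change L.mkQ (f x) = L.mkQ (g (j (q x)))
    rw [← LinearMap.comp_apply L.mkQ g, hg, ← LinearMap.comp_apply L.mkQ f, ← hf', ← hg']
    rfl
  -- `d` agrees with `f` on `ker q`, so `d(Q) ⊆ L = d(ker q)` and `Q = ker q + ker d`.
  have htop : LinearMap.ker d = ⊤ := by
    refine hq.superfluous _ (eq_top_iff.2 fun x _ => ?_)
    obtain ⟨l, hl, hlx⟩ := hdL x
    have hl0 : q l = 0 := hl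
    rw [← add_sub_cancel l x]
    refine Submodule.add_mem_sup hl ?_
    rw [LinearMap.mem_ker, map_sub, ← hlx]
    simp [d, hl0]
  exact ⟨g, (sub_eq_zero.1 (LinearMap.ker_eq_top.1 htop)).symm⟩

/-- Over a right hereditary or right perfect ring, the target of a `𝒯`-envelope of the regular
module has a projective presentation `σ` with `𝒯 ⊆ 𝒟_σ`. -/
theorem IsEnvelope.exists_presentation (hR : IsRightHereditary R ∨ IsRightPerfect R)
    {𝒯 : ModClass R} (h𝒯 : IsTorsionClass 𝒯) {M : RightMod R} {ε : regular R →ₗ[Rᵐᵒᵖ] M}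
    (hε : IsEnvelope 𝒯 ε) :
    ∃ (P₁ P₀ : RightMod R) (σ : P₁ →ₗ[Rᵐᵒᵖ] P₀) (p : P₀ →ₗ[Rᵐᵒᵖ] M),
      IsProjectivePresentation σ p ∧ ∀ X, 𝒯 X → classD σ X := by
  obtain hR | hR := hR
  · let P : RightMod R := ModuleCat.of Rᵐᵒᵖ (M →₀ Rᵐᵒᵖ)
    let p : P →ₗ[Rᵐᵒᵖ] M := Finsupp.linearCombination Rᵐᵒᵖ id
    have hp : Function.Surjective p :=
      Finsupp.linearCombination_surjective _ Function.surjective_id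
    have hP : Module.Projective Rᵐᵒᵖ P :=
      inferInstanceAs (Module.Projective Rᵐᵒᵖ (M →₀ Rᵐᵒᵖ))
    refine ⟨ModuleCat.of Rᵐᵒᵖ (LinearMap.ker p), P, (LinearMap.ker p).subtype, p,
      ⟨projective_submodule_of_isRightHereditary hR hP _, hP, p.exact_subtype_ker_map, hp⟩,
      fun X hX f => ?_⟩
    obtain ⟨g, hg⟩ := hε.exists_extension h𝒯 p hp hX f
    exact ⟨g, LinearMap.ext hg⟩
  · obtain ⟨P, p, hp⟩ := hR M
    obtain ⟨Q, q, hq⟩ := hR (ModuleCat.of Rᵐᵒᵖ (LinearMap.ker p))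
    have := hp.projective
    refine ⟨Q, P, (LinearMap.ker p).subtype ∘ₗ q, p, ⟨hq.projective, hp.projective, ?_,
      hp.surjective⟩, fun X hX f => ?_⟩
    · intro y
      refine ⟨fun hy => ?_, ?_⟩
      · obtain ⟨x, hx⟩ := hq.surjective ⟨y, hy⟩
        exact ⟨x, congrArg Subtype.val hx⟩
      · rintro ⟨x, rfl⟩
        exact (q x).2
    · refine hq.exists_extension _ (fun L f' => ?_) f
      have hXL : 𝒯 (ModuleCat.of Rᵐᵒᵖ (X ⧸ L)) :=
        h𝒯.quotient (Y := ModuleCat.of Rᵐᵒᵖ (X ⧸ L)) L.mkQ L.mkQ_surjective hX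
      obtain ⟨g, hg⟩ := hε.exists_extension h𝒯 p hp.surjective hXL f'
      exact ⟨g, LinearMap.ext hg⟩

/-- A map `P₀ → X` vanishing on the relations `σ` factors through the presented module. -/
theorem IsProjectivePresentation.exists_factor {P₁ P₀ M X : RightMod R}
    {σ : P₁ →ₗ[Rᵐᵒᵖ] P₀} {p : P₀ →ₗ[Rᵐᵒᵖ] M} (h : IsProjectivePresentation σ p)
    (g : P₀ →ₗ[Rᵐᵒᵖ] X) (hg : g ∘ₗ σ = 0) : ∃ g' : M →ₗ[Rᵐᵒᵖ] X, g' ∘ₗ p = g := by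
  refine exists_factor_of_ker_le h.surjective fun y hy => ?_
  obtain ⟨x, rfl⟩ := (h.exact y).1 hy
  exact LinearMap.congr_fun hg x

/-- Let `σ` present `M`, with `𝒯 ⊆ 𝒟_σ`, and let `ε' : R → P₀` lift a `𝒯`-preenvelope `ε : R → M`.
Then `(ε', σ) : R × P₁ → P₀`, which presents the cokernel of `ε`, satisfies `𝒟 = 𝒯`. -/
theorem IsPreenvelope.classD_coprod_eq {𝒯 : ModClass R} (h𝒯 : IsTorsionClass 𝒯)
    {P₁ P₀ M : RightMod R} {ε : regular R →ₗ[Rᵐᵒᵖ] M} (hε : IsPreenvelope 𝒯 ε)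
    {σ : P₁ →ₗ[Rᵐᵒᵖ] P₀} {p : P₀ →ₗ[Rᵐᵒᵖ] M} (hσ : IsProjectivePresentation σ p)
    (hD : ∀ X, 𝒯 X → classD σ X) {ε' : R →ₗ[Rᵐᵒᵖ] P₀} (hε' : p ∘ₗ ε' = ε) :
    classD (P₁ := ModuleCat.of Rᵐᵒᵖ (R × P₁)) (ε'.coprod σ) = 𝒯 := by
  have hpσ : p ∘ₗ σ = 0 := hσ.exact.linearMap_comp_eq_zero
  ext X
  refine ⟨fun hX => ?_, fun hX f => ?_⟩
  · refine h𝒯.of_gen hε.mem (gen_of_factors ε fun f => ?_)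
    -- The zero on `P₁` makes `g` kill the relations, so it descends to `M`.
    obtain ⟨g, hg⟩ := hX (f.coprod 0)
    have hg : g ∘ₗ ε'.coprod σ = f.coprod 0 := hg
    have h1 : g ∘ₗ ε' = f := by
      rw [← LinearMap.coprod_inl (f := f) (g := (0 : P₁ →ₗ[Rᵐᵒᵖ] X)), ← hg,
        LinearMap.comp_assoc, LinearMap.coprod_inl]
    have h2 : g ∘ₗ σ = 0 := by
      rw [← LinearMap.coprod_inr (f := f) (g := (0 : P₁ →ₗ[Rᵐᵒᵖ] X)), ← hg,
        LinearMap.comp_assoc, LinearMap.coprod_inr]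
    obtain ⟨g', rfl⟩ := hσ.exists_factor g h2
    exact ⟨g', by rw [← hε', ← h1]; rfl⟩
  · have hf : (f ∘ₗ LinearMap.inl Rᵐᵒᵖ R P₁).coprod (f ∘ₗ LinearMap.inr Rᵐᵒᵖ R P₁) = f :=
      LinearMap.coprod_comp_inl_inr f
    obtain ⟨g, hg⟩ := hD X hX (f ∘ₗ LinearMap.inr Rᵐᵒᵖ R P₁)
    -- Correct the error on `R` by a map through `p`, harmless on `P₁` because `p ∘ σ = 0`.
    obtain ⟨g', hg'⟩ := hε.factors X hX (f ∘ₗ LinearMap.inl Rᵐᵒᵖ R P₁ - g ∘ₗ ε')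
    refine ⟨g + g' ∘ₗ p, ?_⟩
    change (g + g' ∘ₗ p) ∘ₗ ε'.coprod σ = f
    rw [← hf, LinearMap.comp_coprod]
    congr 1
    · rw [LinearMap.add_comp, LinearMap.comp_assoc, hε', hg', add_sub_cancel]
    · rw [LinearMap.add_comp, LinearMap.comp_assoc, hpσ, LinearMap.comp_zero, add_zero, hg]

/-! ### Direct sums of presentations and the silting module. -/

theorem classD_prodMap {P₁ P₀ Q₁ Q₀ : RightMod R} (σ : P₁ →ₗ[Rᵐᵒᵖ] P₀) (τ : Q₁ →ₗ[Rᵐᵒᵖ] Q₀)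
    (X : RightMod R) :
    classD (P₁ := ModuleCat.of Rᵐᵒᵖ (P₁ × Q₁)) (P₀ := ModuleCat.of Rᵐᵒᵖ (P₀ × Q₀))
      (σ.prodMap τ) X ↔ classD σ X ∧ classD τ X := by
  refine ⟨fun h => ⟨fun f => ?_, fun f => ?_⟩, fun h f => ?_⟩
  · obtain ⟨g, hg⟩ := h (f ∘ₗ LinearMap.fst Rᵐᵒᵖ P₁ Q₁)
    refine ⟨g ∘ₗ LinearMap.inl Rᵐᵒᵖ P₀ Q₀, LinearMap.ext fun x => ?_⟩
    simpa using LinearMap.congr_fun hg (x, 0)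
  · obtain ⟨g, hg⟩ := h (f ∘ₗ LinearMap.snd Rᵐᵒᵖ P₁ Q₁)
    refine ⟨g ∘ₗ LinearMap.inr Rᵐᵒᵖ P₀ Q₀, LinearMap.ext fun x => ?_⟩
    simpa using LinearMap.congr_fun hg (0, x)
  · obtain ⟨g, hg⟩ := h.1 (f ∘ₗ LinearMap.inl Rᵐᵒᵖ P₁ Q₁)
    obtain ⟨k, hk⟩ := h.2 (f ∘ₗ LinearMap.inr Rᵐᵒᵖ P₁ Q₁)
    refine ⟨g.coprod k, LinearMap.prod_ext (LinearMap.ext fun x => ?_)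
      (LinearMap.ext fun x => ?_)⟩
    · simpa using LinearMap.congr_fun hg x
    · simpa using LinearMap.congr_fun hk x

theorem IsProjectivePresentation.prodMap {P₁ P₀ M Q₁ Q₀ N : RightMod R}
    {σ : P₁ →ₗ[Rᵐᵒᵖ] P₀} {p : P₀ →ₗ[Rᵐᵒᵖ] M} {τ : Q₁ →ₗ[Rᵐᵒᵖ] Q₀} {q : Q₀ →ₗ[Rᵐᵒᵖ] N}
    (hσ : IsProjectivePresentation σ p) (hτ : IsProjectivePresentation τ q) :
    IsProjectivePresentation (P₁ := ModuleCat.of Rᵐᵒᵖ (P₁ × Q₁))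
      (P₀ := ModuleCat.of Rᵐᵒᵖ (P₀ × Q₀)) (T := ModuleCat.of Rᵐᵒᵖ (M × N))
      (σ.prodMap τ) (p.prodMap q) := by
  have := hσ.projective₀
  have := hσ.projective₁
  have := hτ.projective₀
  have := hτ.projective₁
  refine ⟨inferInstanceAs (Module.Projective Rᵐᵒᵖ (P₁ × Q₁)),
    inferInstanceAs (Module.Projective Rᵐᵒᵖ (P₀ × Q₀)), fun ⟨x, y⟩ => ⟨fun h => ?_, ?_⟩,
    hσ.surjective.prodMap hτ.surjective⟩
  · obtain ⟨a, ha⟩ := (hσ.exact x).1 (congrArg Prod.fst h)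
    obtain ⟨b, hb⟩ := (hτ.exact y).1 (congrArg Prod.snd h)
    exact ⟨(a, b), Prod.ext ha hb⟩
  · rintro ⟨⟨a, b⟩, hab⟩
    exact Prod.ext ((hσ.exact x).2 ⟨a, congrArg Prod.fst hab⟩)
      ((hτ.exact y).2 ⟨b, congrArg Prod.snd hab⟩)

/-- Over a right hereditary or right perfect ring, a torsion class with an envelope `R → M` of the
regular module is generated by the silting module `M × Coker(R → M)`. -/
theorem IsEnvelope.exists_isSilting (hR : IsRightHereditary R ∨ IsRightPerfect R)
    {𝒯 : ModClass R} (h𝒯 : IsTorsionClass 𝒯) {M : RightMod R} {ε : regular R →ₗ[Rᵐᵒᵖ] M}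
    (hε : IsEnvelope 𝒯 ε) : ∃ T : RightMod R, IsSilting T ∧ 𝒯 = Gen T := by
  obtain ⟨P₁, P₀, σ, p, hσ, hD⟩ := hε.exists_presentation hR h𝒯
  obtain ⟨ε', hε'⟩ := Module.projective_lifting_property (P := R) p ε hσ.surjective
  let τ : ModuleCat.of Rᵐᵒᵖ (R × P₁) →ₗ[Rᵐᵒᵖ] P₀ := ε'.coprod σ
  have hτD : classD τ = 𝒯 := hε.classD_coprod_eq h𝒯 hσ hD hε'
  let C : RightMod R := ModuleCat.of Rᵐᵒᵖ (P₀ ⧸ LinearMap.range τ)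
  let c : P₀ →ₗ[Rᵐᵒᵖ] C := (LinearMap.range τ).mkQ
  have hc : Function.Surjective c := (LinearMap.range τ).mkQ_surjective
  have := hσ.projective₁
  have hτ : IsProjectivePresentation τ c :=
    ⟨inferInstanceAs (Module.Projective Rᵐᵒᵖ (R × P₁)), hσ.projective₀,
      LinearMap.exact_map_mkQ_range τ, hc⟩
  have hC : 𝒯 C := by
    -- `c` kills the image of `σ`, so `C` is a quotient of `M`.
    obtain ⟨g, hg⟩ := hσ.exists_factor c (LinearMap.ext fun x =>
      (Submodule.Quotient.mk_eq_zero _).2 ⟨(0, x), by simp [τ]⟩)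
    refine h𝒯.quotient g (Function.Surjective.of_comp (g := p) ?_) hε.mem
    rw [← LinearMap.coe_comp, hg]
    exact hc
  let T : RightMod R := ModuleCat.of Rᵐᵒᵖ (M × C)
  have hT : 𝒯 T := h𝒯.prod hε.mem hC
  have hgen : 𝒯 = Gen T := by
    ext X
    exact ⟨fun hX => (gen_of_factors ε (hε.factors X hX)).of_surjective
      (LinearMap.fst Rᵐᵒᵖ M C) LinearMap.fst_surjective, h𝒯.of_gen hT⟩
  have hDtot : classD (P₁ := ModuleCat.of Rᵐᵒᵖ (P₁ × (R × P₁)))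
      (P₀ := ModuleCat.of Rᵐᵒᵖ (P₀ × P₀)) (σ.prodMap τ) = 𝒯 := by
    ext X
    refine (classD_prodMap σ τ X).trans ?_
    rw [hτD]
    exact ⟨And.right, fun hX => ⟨hD X hX, hX⟩⟩
  refine ⟨T, ⟨_, _, _, _, ⟨hσ.prodMap hτ, ?_, ?_⟩, ?_⟩, hgen⟩
  · exact hDtot.symm ▸ h𝒯
  · exact hDtot.symm ▸ hT
  · exact hDtot.trans hgen

end Silting

theorem mainTheorem4 {R : Type u} [Ring R]
    (hR : Silting.IsRightHereditary R ∨ Silting.IsRightPerfect R)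
    (𝒯 : Silting.ModClass R) (h𝒯 : Silting.IsTorsionClass 𝒯) :
    ((∃ T : Silting.RightMod R, Silting.IsMinimalSilting T ∧ 𝒯 = Silting.Gen T) ↔
        Silting.HasEnvelope 𝒯 (Silting.regular R)) ∧
      (Silting.IsEnveloping 𝒯 →
        ∃ T : Silting.RightMod R, Silting.IsSilting T ∧ 𝒯 = Silting.Gen T) := by
  refine ⟨⟨?_, fun h => ?_⟩, fun h => ?_⟩
  · rintro ⟨T, hT, rfl⟩
    exact hT.envelope
  · obtain ⟨M, ε, hε⟩ := h
    obtain ⟨T, hT, hgen⟩ := hε.exists_isSilting hR h𝒯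
    exact ⟨T, ⟨hT, hgen ▸ ⟨M, ε, hε⟩⟩, hgen⟩
  · obtain ⟨M, ε, hε⟩ := h (Silting.regular R)
    exact hε.exists_isSilting hR h𝒯
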